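/- Let $n\ge 1$. A body in $\mathbb R^n$ is a compact convex set with non-empty interior. Let $C\subset\mathbb R^n$ be a body with $C=-C$ and let $K\subset\mathbb R^n$ be a body. For $u\in\mathbb R^n\setminus\{0\}$ put $$b_u(K,C)=\frac{\max_{x,y\in K}u^T(x-y)}{\max_{x\in C}u^Tx},\qquad w(K,C)=\min_{u\ne 0}b_u(K,C),\qquad D(K,C)=\max_{u\neq 0}b_u(K,C),$$ and let $$R(K,C)=\inf\{\rho>0: K\subset \rho C+t \text{ for some } t\in\mathbb R^n\},\qquad r(K,C)=\sup\{\rho>0: \rho C\subset K+t\text{ for some } t\in\mathbb R^n\},$$ $$s(K)=\inf\{\rho>0: K-c\subset\rho(c-K)\text{ for some } c\in\mathbb R^n\}.$$ Call $K$ pseudo-complete with respect to $C$ if $r(K,C)+R(K,C)=D(K,C)$, and complete with respect to $C$ if every proper superset of $K$ has a greater diameter with respect to $C$ than $K$ (the diameter of an arbitrary set being the supremum of its breadths $b_u$, with maxima replaced by suprema; it is infinite for unbounded sets). (1) If $K$ is pseudo-complete with respect to $C$, then $$\frac{D(K,C)}{w(K,C)}\le\frac{s(K)+1}{2}.$$ (2)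 If $n>2$ is odd and $s\in[1,n]$, or if $n>2$ is even and $s\in[1,n-1]$, then there exist a body $K\subset\mathbb R^n$ and a body $C=-C\subset\mathbb R^n$ such that $K$ is complete with respect to $C$, $s(K)=s$ and $$\frac{D(K,C)}{w(K,C)}=\frac{s+1}{2}.$$ -/

import Mathlib

open scoped Pointwise

noncomputable section

/-- A (convex) body of `ℝⁿ`: a full-dimensional compact convex set. -/
structure IsBody {n : ℕ} (K : Set (EuclideanSpace ℝ (Fin n))) : Prop where
  convex : Convex ℝ K
  isCompact : IsCompact K
  interior_nonempty : (interior K).Nonempty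

/-- A gauge body of `ℝⁿ`: a body `C` that is 0-symmetric, `C = -C`. -/
structure IsGaugeBody {n : ℕ} (C : Set (EuclideanSpace ℝ (Fin n))) : Prop extends IsBody C where
  symm : C = -C

/-- The Minkowski asymmetry `s(K) = inf {ρ > 0 : K - c ⊆ ρ (c - K), c ∈ ℝⁿ}`. -/
def minkowskiAsymmetry {n : ℕ} (K : Set (EuclideanSpace ℝ (Fin n))) : ℝ :=
  sInf {ρ : ℝ | 0 < ρ ∧ ∃ c : EuclideanSpace ℝ (Fin n), K - {c} ⊆ ρ • ({c} - K)}

/-- `max {⟪u, x⟫ : x ∈ A}`, the support function of `A` at `u`. -/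
def supportFun {n : ℕ} (A : Set (EuclideanSpace ℝ (Fin n))) (u : EuclideanSpace ℝ (Fin n)) : ℝ :=
  sSup ((fun x => inner ℝ u x) '' A)

/-- The breadth of `K` with respect to `C` in the direction `u`:
`max {⟪u, x - y⟫ : x, y ∈ K} / max {⟪u, x⟫ : x ∈ C}`. -/
def breadth {n : ℕ} (u : EuclideanSpace ℝ (Fin n)) (K C : Set (EuclideanSpace ℝ (Fin n))) : ℝ :=
  supportFun (K - K) u / supportFun C u

/-- The width `w(K, C)`: the minimal breadth over all nonzero directions. -/
def bodyWidth {n : ℕ} (K C : Set (EuclideanSpace ℝ (Fin n))) : ℝ :=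
  ⨅ u : {u : EuclideanSpace ℝ (Fin n) // u ≠ 0}, breadth u.1 K C

/-- The diameter `D(K, C)`: the maximal breadth over all nonzero directions. -/
def bodyDiam {n : ℕ} (K C : Set (EuclideanSpace ℝ (Fin n))) : ℝ :=
  ⨆ u : {u : EuclideanSpace ℝ (Fin n) // u ≠ 0}, breadth u.1 K C

/-- The circumradius `R(K, C) = inf {ρ > 0 : K ⊆ ρ C + t for some t ∈ ℝⁿ}`. -/
def circumradius {n : ℕ} (K C : Set (EuclideanSpace ℝ (Fin n))) : ℝ :=
  sInf {ρ : ℝ | 0 < ρ ∧ ∃ t : EuclideanSpace ℝ (Fin n), K ⊆ ρ • C + {t}}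

/-- The inradius `r(K, C) = sup {ρ > 0 : ρ C ⊆ K + t for some t ∈ ℝⁿ}`. -/
def inradius {n : ℕ} (K C : Set (EuclideanSpace ℝ (Fin n))) : ℝ :=
  sSup {ρ : ℝ | 0 < ρ ∧ ∃ t : EuclideanSpace ℝ (Fin n), ρ • C ⊆ K + {t}}

/-- `K` is pseudo-complete with respect to `C`: `r(K, C) + R(K, C) = D(K, C)`. -/
def IsPseudoComplete {n : ℕ} (K C : Set (EuclideanSpace ℝ (Fin n))) : Prop :=
  inradius K C + circumradius K C = bodyDiam K C

/-- `K` is (diametrically) complete with respect to `C`: every proper superset of `K` has a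
greater diameter.  Unbounded supersets have infinite diameter, so that only the bounded ones
(on which the real-valued `bodyDiam` is the true supremum) impose a condition. -/
def IsDiamComplete {n : ℕ} (K C : Set (EuclideanSpace ℝ (Fin n))) : Prop :=
  ∀ L : Set (EuclideanSpace ℝ (Fin n)), Bornology.IsBounded L → K ⊂ L → bodyDiam K C < bodyDiam L C

end

/-!
For the inequality, the centre of asymmetry `c` puts `K - c` into `s / (s + 1) • (K - K)`, hence
into `s D / (s + 1) • C`. So `(s + 1) R ≤ s D`, pseudo-completeness turns this into
`D ≤ (s + 1) r`, and `2 r ≤ w` always.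

For sharpness, embed `ℝⁿ` as a hyperplane `∑ i ∈ T, v i = 0` of `ℝⁿ⁺¹`, where `#T = m + 1`, and
let `K` and `C` be its sections with the cubes `[-1, s]ⁿ⁺¹` and `[-1, 1]ⁿ⁺¹`. Diameters with
respect to `C` are diameters in the maximum norm; as every facet of `[-1, s]ⁿ⁺¹` meets the
hyperplane, the diameter of `K` is `s + 1` and `K` is complete. When `m` is odd, `T` splits into two
halves of equal size, and the sum of the coordinates in one half is a direction of breadth `2`.
-/

section SupportFunction

variable {n : ℕ} {A B : Set (EuclideanSpace ℝ (Fin n))} {u x : EuclideanSpace ℝ (Fin n)}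

theorem inner_le_supportFun (hA : Bornology.IsBounded A) (hx : x ∈ A) :
    inner ℝ u x ≤ supportFun A u := by
  obtain ⟨M, hM⟩ := hA.exists_norm_le
  refine le_csSup ⟨‖u‖ * M, ?_⟩ ⟨x, hx, rfl⟩
  rintro _ ⟨y, hy, rfl⟩
  exact (real_inner_le_norm u y).trans (mul_le_mul_of_nonneg_left (hM y hy) (norm_nonneg u))

theorem supportFun_le {c : ℝ} (hc : 0 ≤ c) (h : ∀ x ∈ A, inner ℝ u x ≤ c) :
    supportFun A u ≤ c :=
  Real.sSup_le (Set.forall_mem_image.2 h) hc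

theorem supportFun_nonneg (hA : (0 : EuclideanSpace ℝ (Fin n)) ∈ A) : 0 ≤ supportFun A u :=
  Real.sSup_nonneg' ⟨0, ⟨0, hA, inner_zero_right u⟩, le_rfl⟩

theorem supportFun_sub_self_nonneg : 0 ≤ supportFun (A - A) u := by
  rcases A.eq_empty_or_nonempty with rfl | hA
  · simp [supportFun]
  · exact supportFun_nonneg hA.zero_mem_sub

theorem supportFun_mono (hA : (0 : EuclideanSpace ℝ (Fin n)) ∈ A) (hB : Bornology.IsBounded B)
    (h : A ⊆ B) : supportFun A u ≤ supportFun B u :=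
  supportFun_le (supportFun_nonneg (h hA)) fun _ hx => inner_le_supportFun hB (h hx)

theorem supportFun_smul {c : ℝ} (hc : 0 ≤ c) : supportFun (c • A) u = c * supportFun A u := by
  rw [supportFun, Set.image_smul_comm _ c A fun x => real_inner_smul_right u x c,
    Real.sSup_smul_of_nonneg hc, smul_eq_mul, supportFun]

theorem exists_inner_eq_linearMap (φ : EuclideanSpace ℝ (Fin n) →ₗ[ℝ] ℝ) :
    ∃ u, ∀ x, inner ℝ u x = φ x :=
  ⟨(InnerProductSpace.toDual ℝ _).symm φ.toContinuousLinearMap, fun _ => by simp⟩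

theorem mem_of_forall_inner_le_supportFun (hconv : Convex ℝ A) (hcomp : IsCompact A)
    (hne : A.Nonempty) (h : ∀ u, inner ℝ u x ≤ supportFun A u) : x ∈ A := by
  by_contra hx
  obtain ⟨f, t, hft, htf⟩ := geometric_hahn_banach_closed_point hconv hcomp.isClosed hx
  obtain ⟨u, hu⟩ := exists_inner_eq_linearMap f.toLinearMap
  obtain ⟨a, ha, hmax⟩ := hcomp.exists_sSup_image_eq hne (f := fun x => inner ℝ u x) (by fun_prop)
  have hsep : supportFun A u < inner ℝ u x := by
    rw [supportFun, hmax, hu, hu]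
    exact (hft a ha).trans htf
  exact (h u).not_gt hsep

end SupportFunction

section GaugeBody

variable {n : ℕ} {C L : Set (EuclideanSpace ℝ (Fin n))} {u x : EuclideanSpace ℝ (Fin n)}

theorem exists_subset_smul_of_mem_nhds_zero {E : Type*} [NormedAddCommGroup E] [NormedSpace ℝ E]
    {A B : Set E} (hA : A ∈ nhds 0) (hB : Bornology.IsBounded B) : ∃ ρ : ℝ, 0 < ρ ∧ B ⊆ ρ • A := by
  obtain ⟨ρ, hρ, h⟩ := (NormedSpace.isVonNBounded_of_isBounded ℝ hB hA).exists_pos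
  exact ⟨ρ, hρ, h ρ (le_abs_self ρ)⟩

theorem IsGaugeBody.neg_mem (hC : IsGaugeBody C) (hx : x ∈ C) : -x ∈ C :=
  Set.mem_neg.1 (hC.symm ▸ hx)

theorem IsGaugeBody.mem_nhds_zero (hC : IsGaugeBody C) : C ∈ nhds 0 := by
  obtain ⟨x, hx⟩ := hC.interior_nonempty
  have h := hC.convex.combo_interior_self_mem_interior hx (hC.neg_mem (interior_subset hx))
    (a := 1 / 2) (b := 1 / 2) (by norm_num) (by norm_num) (by norm_num)
  exact mem_interior_iff_mem_nhds.1 (by simpa using h)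

theorem IsGaugeBody.zero_mem (hC : IsGaugeBody C) : 0 ∈ C :=
  mem_of_mem_nhds hC.mem_nhds_zero

theorem IsGaugeBody.supportFun_pos (hC : IsGaugeBody C) (hu : u ≠ 0) : 0 < supportFun C u := by
  obtain ⟨ρ, hρ, h⟩ := exists_subset_smul_of_mem_nhds_zero hC.mem_nhds_zero
    (Bornology.isBounded_singleton (x := u))
  obtain ⟨c, hc, hcu⟩ := h rfl
  have hinner : 0 < ρ * inner ℝ u c := by
    rw [← real_inner_smul_right, show ρ • c = u from hcu]
    exact real_inner_self_pos.2 hu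
  exact (pos_of_mul_pos_right hinner hρ.le).trans_le (inner_le_supportFun hC.isCompact.isBounded hc)

theorem breadth_nonneg (hC : IsGaugeBody C) : 0 ≤ breadth u L C :=
  div_nonneg supportFun_sub_self_nonneg (supportFun_nonneg hC.zero_mem)

theorem bodyDiam_nonneg (hC : IsGaugeBody C) : 0 ≤ bodyDiam L C :=
  Real.iSup_nonneg fun _ => breadth_nonneg hC

theorem bodyWidth_nonneg (hC : IsGaugeBody C) : 0 ≤ bodyWidth L C :=
  Real.iInf_nonneg fun _ => breadth_nonneg hC

theorem breadth_le_of_sub_subset_smul {d : ℝ} (hC : IsGaugeBody C) (hd : 0 ≤ d)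
    (h : L - L ⊆ d • C) : breadth u L C ≤ d := by
  refine div_le_of_le_mul₀ (supportFun_nonneg hC.zero_mem) hd ?_
  rw [← supportFun_smul hd]
  have hdC : 0 ∈ d • C := ⟨0, hC.zero_mem, smul_zero d⟩
  exact supportFun_le (supportFun_nonneg hdC) fun x hx =>
    inner_le_supportFun (hC.isCompact.smul d).isBounded (h hx)

theorem supportFun_sub_self_le_bodyDiam_mul (hC : IsGaugeBody C) (hL : Bornology.IsBounded L) :
    supportFun (L - L) u ≤ bodyDiam L C * supportFun C u := by
  rcases eq_or_ne u 0 with rfl | hu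
  · refine supportFun_le (mul_nonneg (bodyDiam_nonneg hC) (supportFun_nonneg hC.zero_mem)) ?_
    simpa using fun _ _ => mul_nonneg (bodyDiam_nonneg hC) (supportFun_nonneg hC.zero_mem)
  · obtain ⟨d, hd, hLd⟩ := exists_subset_smul_of_mem_nhds_zero hC.mem_nhds_zero (hL.sub hL)
    have hbdd : BddAbove (Set.range fun v : {v : EuclideanSpace ℝ (Fin n) // v ≠ 0} =>
        breadth v.1 L C) :=
      ⟨d, Set.forall_mem_range.2 fun _ => breadth_le_of_sub_subset_smul hC hd.le hLd⟩
    exact (div_le_iff₀ (hC.supportFun_pos hu)).1 (le_ciSup hbdd ⟨u, hu⟩)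

theorem bodyDiam_le_iff {d : ℝ} (hC : IsGaugeBody C) (hL : Bornology.IsBounded L) (hd : 0 ≤ d) :
    bodyDiam L C ≤ d ↔ L - L ⊆ d • C := by
  refine ⟨fun h z hz => ?_, fun h =>
    Real.iSup_le (fun _ => breadth_le_of_sub_subset_smul hC hd h) hd⟩
  refine mem_of_forall_inner_le_supportFun (hC.convex.smul d) (hC.isCompact.smul d)
    ⟨0, 0, hC.zero_mem, smul_zero d⟩ fun u => ?_
  calc inner ℝ u z ≤ supportFun (L - L) u := inner_le_supportFun (hL.sub hL) hz
    _ ≤ bodyDiam L C * supportFun C u := supportFun_sub_self_le_bodyDiam_mul hC hL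
    _ ≤ d * supportFun C u := mul_le_mul_of_nonneg_right h (supportFun_nonneg hC.zero_mem)
    _ = supportFun (d • C) u := (supportFun_smul hd).symm

theorem sub_subset_bodyDiam_smul (hC : IsGaugeBody C) (hL : Bornology.IsBounded L) :
    L - L ⊆ bodyDiam L C • C :=
  (bodyDiam_le_iff hC hL (bodyDiam_nonneg hC)).1 le_rfl

theorem bodyDiam_pos (hC : IsGaugeBody C) (hL : Bornology.IsBounded L) (hne : L.Nontrivial) :
    0 < bodyDiam L C := by
  obtain ⟨x, hx, y, hy, hxy⟩ := hne
  refine (bodyDiam_nonneg hC).lt_of_ne' fun h0 => hxy (sub_eq_zero.1 ?_)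
  have h := sub_subset_bodyDiam_smul hC hL (Set.sub_mem_sub hx hy)
  rwa [h0, Set.zero_smul_set ⟨0, hC.zero_mem⟩] at h

theorem isDiamComplete_of_forall_mem (hC : IsGaugeBody C)
    (h : ∀ z, (∀ y ∈ L, z - y ∈ bodyDiam L C • C) → z ∈ L) : IsDiamComplete L C := by
  intro M hM hLM
  obtain ⟨hsub, z, hzM, hzL⟩ := Set.ssubset_iff_exists.1 hLM
  contrapose! hzL
  exact h z fun y hy =>
    (bodyDiam_le_iff hC hM (bodyDiam_nonneg hC)).1 hzL (Set.sub_mem_sub hzM (hsub hy))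

theorem le_bodyWidth_of_smul_subset [NeZero n] {ρ : ℝ} {t : EuclideanSpace ℝ (Fin n)}
    (hC : IsGaugeBody C) (hL : Bornology.IsBounded L) (hρ : 0 ≤ ρ) (h : ρ • C ⊆ L + {t}) :
    2 * ρ ≤ bodyWidth L C := by
  have hmem {c} (hc : c ∈ C) : ∃ x ∈ L, x + t = ρ • c := by
    obtain ⟨x, hx, _, rfl, hxc⟩ := h (Set.smul_mem_smul_set hc)
    exact ⟨x, hx, hxc⟩
  have hsub : (2 * ρ) • C ⊆ L - L := by
    rintro _ ⟨c, hc, rfl⟩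
    obtain ⟨x, hx, hxc⟩ := hmem hc
    obtain ⟨y, hy, hyc⟩ := hmem (hC.neg_mem hc)
    refine ⟨x, hx, y, hy, ?_⟩
    calc x - y = (x + t) - (y + t) := by abel
      _ = ρ • c - ρ • (-c) := congrArg₂ (· - ·) hxc hyc
      _ = (2 * ρ) • c := by module
  have : Nonempty {u : EuclideanSpace ℝ (Fin n) // u ≠ 0} := nonempty_subtype.2 (exists_ne 0)
  refine le_ciInf fun u => (le_div_iff₀ (hC.supportFun_pos u.2)).2 ?_
  rw [← supportFun_smul (by positivity)]
  exact supportFun_mono ⟨0, hC.zero_mem, smul_zero _⟩ (hL.sub hL) hsub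

theorem two_mul_inradius_le_bodyWidth [NeZero n] (hC : IsGaugeBody C) (hL : Bornology.IsBounded L) :
    2 * inradius L C ≤ bodyWidth L C := by
  have h : inradius L C ≤ bodyWidth L C / 2 := by
    refine Real.sSup_le ?_ (div_nonneg (bodyWidth_nonneg hC) zero_le_two)
    rintro ρ ⟨hρ, t, ht⟩
    linarith [le_bodyWidth_of_smul_subset hC hL hρ.le ht]
  linarith

theorem bodyWidth_le_of_linearMap {w : ℝ} {c : EuclideanSpace ℝ (Fin n)}
    (φ : EuclideanSpace ℝ (Fin n) →ₗ[ℝ] ℝ) (hC : IsGaugeBody C) (hw : 0 ≤ w) (hc : c ∈ C)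
    (hφc : 0 < φ c) (h : ∀ x ∈ L, ∀ y ∈ L, φ x - φ y ≤ w * φ c) : bodyWidth L C ≤ w := by
  obtain ⟨u, hu⟩ := exists_inner_eq_linearMap φ
  have hu0 : u ≠ 0 := by
    rintro rfl
    exact hφc.ne (by rw [← hu, inner_zero_left])
  have hbdd : BddBelow (Set.range fun v : {v : EuclideanSpace ℝ (Fin n) // v ≠ 0} =>
      breadth v.1 L C) := ⟨0, Set.forall_mem_range.2 fun _ => breadth_nonneg hC⟩
  refine (ciInf_le hbdd ⟨u, hu0⟩).trans ((div_le_iff₀ (hC.supportFun_pos hu0)).2 ?_)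
  calc supportFun (L - L) u ≤ w * φ c := by
        refine supportFun_le (by positivity) ?_
        rintro _ ⟨x, hx, y, hy, rfl⟩
        simpa only [hu, map_sub] using h x hx y hy
    _ ≤ w * supportFun C u := by
        rw [← hu]
        exact mul_le_mul_of_nonneg_left (inner_le_supportFun hC.isCompact.isBounded hc) hw

end GaugeBody

section Asymmetry

variable {n : ℕ} {C K : Set (EuclideanSpace ℝ (Fin n))} {ρ : ℝ} {c : EuclideanSpace ℝ (Fin n)}

theorem sub_singleton_subset_smul_iff :
    K - {c} ⊆ ρ • ({c} - K) ↔ ∀ x ∈ K, ∃ y ∈ K, ρ • (c - y) = x - c := by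
  simp only [Set.sub_singleton, Set.singleton_sub, Set.subset_def, Set.forall_mem_image,
    Set.mem_smul_set, Set.exists_mem_image]

theorem exists_sub_singleton_subset_smul (hK : Bornology.IsBounded K)
    (hint : (interior K).Nonempty) :
    ∃ ρ : ℝ, 0 < ρ ∧ ∃ c, K - {c} ⊆ ρ • ({c} - K) := by
  obtain ⟨c, hc⟩ := hint
  have hnhds : {c} - K ∈ nhds 0 := by
    have hcont : ContinuousAt (fun x => c - x) 0 := by fun_prop
    have hpre : (fun x => c - x) ⁻¹' K ∈ nhds 0 :=
      hcont.preimage_mem_nhds (by simpa using mem_interior_iff_mem_nhds.1 hc)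
    rwa [Set.singleton_sub, Set.image_eq_preimage_of_inverse (sub_sub_cancel c) (sub_sub_cancel c)]
  obtain ⟨ρ, hρ, h⟩ := exists_subset_smul_of_mem_nhds_zero hnhds
    (hK.sub (Bornology.isBounded_singleton (x := c)))
  exact ⟨ρ, hρ, c, h⟩

theorem minkowskiAsymmetry_nonneg : 0 ≤ minkowskiAsymmetry K :=
  Real.sInf_nonneg fun _ hρ => hρ.1.le

theorem circumradius_le_of_sub_singleton_subset_smul (hC : IsGaugeBody C)
    (hK : Bornology.IsBounded K) (hne : K.Nontrivial) (hρ : 0 < ρ)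
    (h : K - {c} ⊆ ρ • ({c} - K)) :
    circumradius K C ≤ ρ / (ρ + 1) * bodyDiam K C := by
  have hD := bodyDiam_pos hC hK hne
  refine csInf_le ⟨0, fun _ hr => hr.1.le⟩ ⟨by positivity, c, fun x hx => ?_⟩
  obtain ⟨y, hy, hxy⟩ := sub_singleton_subset_smul_iff.1 h x hx
  obtain ⟨z, hz, hxyz : bodyDiam K C • z = x - y⟩ :=
    sub_subset_bodyDiam_smul hC hK (Set.sub_mem_sub hx hy)
  have hρxy : ρ • (x - y) = (ρ + 1) • (x - c) := by
    calc ρ • (x - y) = ρ • (c - y) + ρ • (x - c) := by module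
      _ = (ρ + 1) • (x - c) := by rw [hxy]; module
  refine ⟨_, ⟨z, hz, rfl⟩, c, rfl, ?_⟩
  calc (ρ / (ρ + 1) * bodyDiam K C) • z + c = (ρ + 1)⁻¹ • ρ • (x - y) + c := by
        rw [← hxyz]
        module
    _ = x := by rw [hρxy, inv_smul_smul₀ (by positivity), sub_add_cancel]

theorem minkowskiAsymmetry_add_one_mul_circumradius_le [NeZero n] (hC : IsGaugeBody C)
    (hK : Bornology.IsBounded K) (hint : (interior K).Nonempty) :
    (minkowskiAsymmetry K + 1) * circumradius K C ≤ minkowskiAsymmetry K * bodyDiam K C := by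
  have hclosed : IsClosed {ρ : ℝ | (ρ + 1) * circumradius K C ≤ ρ * bodyDiam K C} :=
    isClosed_le (by fun_prop) (by fun_prop)
  refine closure_minimal ?_ hclosed (csInf_mem_closure (exists_sub_singleton_subset_smul hK hint)
    ⟨0, fun _ hρ => hρ.1.le⟩)
  rintro ρ ⟨hρ, c, hc⟩
  have hne : K.Nontrivial :=
    have ⟨x, hx⟩ := hint
    (infinite_of_mem_nhds x (mem_interior_iff_mem_nhds.1 hx)).nontrivial
  have h := circumradius_le_of_sub_singleton_subset_smul hC hK hne hρ hc
  rwa [div_mul_eq_mul_div, le_div_iff₀' (by positivity)] at h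

theorem IsPseudoComplete.bodyDiam_div_bodyWidth_le [NeZero n] (hC : IsGaugeBody C)
    (hK : Bornology.IsBounded K) (hint : (interior K).Nonempty) (h : IsPseudoComplete K C) :
    bodyDiam K C / bodyWidth K C ≤ (minkowskiAsymmetry K + 1) / 2 := by
  have hs : 0 ≤ minkowskiAsymmetry K := minkowskiAsymmetry_nonneg
  have hR := minkowskiAsymmetry_add_one_mul_circumradius_le hC hK hint
  rw [IsPseudoComplete] at h
  refine div_le_of_le_mul₀ (bodyWidth_nonneg hC) (by positivity) ?_
  calc bodyDiam K C ≤ (minkowskiAsymmetry K + 1) * inradius K C := by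
        linear_combination hR - (minkowskiAsymmetry K + 1) * h
    _ = (minkowskiAsymmetry K + 1) / 2 * (2 * inradius K C) := by ring
    _ ≤ (minkowskiAsymmetry K + 1) / 2 * bodyWidth K C := by
        gcongr
        exact two_mul_inradius_le_bodyWidth hC hK

end Asymmetry

section BoxSection

variable {n : ℕ} {ι : Type*} {f : EuclideanSpace ℝ (Fin n) →ₗ[ℝ] ι → ℝ} {s : ℝ}
  {x : EuclideanSpace ℝ (Fin n)}

/-- The section of the cube `[-1, s]^ι` with the range of `f`, pulled back to `ℝⁿ`. For injective
`f`, the gauge body is `boxSection f 1`, whose norm is the maximum norm of `f x`, and the extremal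
body is `boxSection f s`. -/
def boxSection (f : EuclideanSpace ℝ (Fin n) →ₗ[ℝ] ι → ℝ) (s : ℝ) :
    Set (EuclideanSpace ℝ (Fin n)) :=
  f ⁻¹' Set.Icc (fun _ => -1) (fun _ => s)

theorem mem_boxSection : x ∈ boxSection f s ↔ ∀ i, f x i ∈ Set.Icc (-1) s := by
  simp only [boxSection, Set.mem_preimage, Set.mem_Icc, Pi.le_def, forall_and]

theorem mem_boxSection_one : x ∈ boxSection f 1 ↔ ∀ i, |f x i| ≤ 1 := by
  simp only [mem_boxSection, Set.mem_Icc, abs_le]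

theorem boxSection_mono : Monotone (boxSection f) := fun _ _ hst =>
  Set.preimage_mono (Set.Icc_subset_Icc_right fun _ => hst)

theorem isBody_boxSection [Finite ι] (hf : Function.Injective f) (hs : 0 < s) :
    IsBody (boxSection f s) where
  convex := (convex_Icc _ _).linear_preimage f
  isCompact :=
    (f.isClosedEmbedding_of_injective (LinearMap.ker_eq_bot.2 hf)).isCompact_preimage isCompact_Icc
  interior_nonempty := by
    have := Fintype.ofFinite ι
    refine ⟨0, mem_interior_iff_mem_nhds.2
      (f.continuous_of_finiteDimensional.continuousAt.preimage_mem_nhds ?_)⟩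
    rw [map_zero]
    exact pi_Icc_mem_nhds (fun _ => neg_one_lt_zero) (fun _ => hs)

theorem isGaugeBody_boxSection_one [Finite ι] (hf : Function.Injective f) :
    IsGaugeBody (boxSection f 1) where
  toIsBody := isBody_boxSection hf one_pos
  symm := by
    ext x
    simp only [Set.mem_neg, mem_boxSection_one, map_neg, Pi.neg_apply, abs_neg]

theorem mem_smul_boxSection_one {d : ℝ} (hd : 0 < d) :
    x ∈ d • boxSection f 1 ↔ ∀ i, |f x i| ≤ d := by
  simp only [Set.mem_smul_set_iff_inv_smul_mem₀ hd.ne', mem_boxSection_one, map_smul, Pi.smul_apply,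
    smul_eq_mul, abs_mul, abs_inv, abs_of_pos hd, inv_mul_le_one₀ hd]

theorem bodyDiam_boxSection [Finite ι] [Nonempty ι] (hf : Function.Injective f) (hs : 0 < s)
    (hsurj : ∀ i, Set.SurjOn (f · i) (boxSection f s) (Set.Icc (-1) s)) :
    bodyDiam (boxSection f s) (boxSection f 1) = s + 1 := by
  have hC := isGaugeBody_boxSection_one hf
  have hb := (isBody_boxSection hf hs).isCompact.isBounded
  apply le_antisymm
  · rw [bodyDiam_le_iff hC hb (by positivity)]
    rintro _ ⟨x, hx, y, hy, rfl⟩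
    rw [mem_smul_boxSection_one (by positivity)]
    intro i
    have hxi := mem_boxSection.1 hx i
    have hyi := mem_boxSection.1 hy i
    rw [map_sub, Pi.sub_apply, abs_le]
    constructor <;> linarith [hxi.1, hxi.2, hyi.1, hyi.2]
  · obtain ⟨i⟩ := ‹Nonempty ι›
    obtain ⟨x, hx, hxi : f x i = s⟩ := hsurj i (Set.right_mem_Icc.2 (by linarith))
    obtain ⟨y, hy, hyi : f y i = -1⟩ := hsurj i (Set.left_mem_Icc.2 (by linarith))
    have hxy : x ≠ y := by
      rintro rfl
      linarith
    have h := (mem_smul_boxSection_one (bodyDiam_pos hC hb ⟨x, hx, y, hy, hxy⟩)).1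
      (sub_subset_bodyDiam_smul hC hb (Set.sub_mem_sub hx hy)) i
    rw [map_sub, Pi.sub_apply, hxi, hyi] at h
    linarith [le_abs_self (s - -1)]

theorem isDiamComplete_boxSection [Finite ι] [Nonempty ι] (hf : Function.Injective f) (hs : 0 < s)
    (hsurj : ∀ i, Set.SurjOn (f · i) (boxSection f s) (Set.Icc (-1) s)) :
    IsDiamComplete (boxSection f s) (boxSection f 1) := by
  refine isDiamComplete_of_forall_mem (isGaugeBody_boxSection_one hf) fun z hz =>
    mem_boxSection.2 fun i => ?_
  rw [bodyDiam_boxSection hf hs hsurj] at hz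
  have hdist : ∀ y ∈ boxSection f s, |f z i - f y i| ≤ s + 1 := fun y hy => by
    simpa using (mem_smul_boxSection_one (by positivity)).1 (hz y hy) i
  obtain ⟨x, hx, hxi : f x i = s⟩ := hsurj i (Set.right_mem_Icc.2 (by linarith))
  obtain ⟨y, hy, hyi : f y i = -1⟩ := hsurj i (Set.left_mem_Icc.2 (by linarith))
  constructor
  · linarith [(abs_le.1 (hdist x hx)).1]
  · linarith [(abs_le.1 (hdist y hy)).2]

theorem minkowskiAsymmetry_boxSection_le (hs : 1 ≤ s) :
    minkowskiAsymmetry (boxSection f s) ≤ s := by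
  have hs0 : 0 < s := by positivity
  refine csInf_le ⟨0, fun _ hρ => hρ.1.le⟩ ⟨hs0, 0,
    sub_singleton_subset_smul_iff.2 fun x hx =>
      ⟨-(s⁻¹ • x), mem_boxSection.2 fun i => ?_, by simp [smul_smul, hs0.ne']⟩⟩
  obtain ⟨hlow, hupp⟩ := mem_boxSection.1 hx i
  rw [map_neg, map_smul, Pi.neg_apply, Pi.smul_apply, smul_eq_mul, inv_mul_eq_div, ← neg_div]
  constructor
  · rw [le_div_iff₀ hs0]
    linarith
  · rw [div_le_iff₀ hs0]
    nlinarith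

theorem le_minkowskiAsymmetry_boxSection [Finite ι] {T : Finset ι} (hf : Function.Injective f)
    (hs : 0 < s) (hT : T.Nonempty) (hsum : ∀ x, ∑ i ∈ T, f x i = 0)
    (hsurj : ∀ i, Set.SurjOn (f · i) (boxSection f s) (Set.Icc (-1) s)) :
    s ≤ minkowskiAsymmetry (boxSection f s) := by
  have hK := isBody_boxSection hf hs
  refine le_csInf (exists_sub_singleton_subset_smul hK.isCompact.isBounded hK.interior_nonempty) ?_
  rintro ρ ⟨hρ, c, hc⟩
  have hcoord (i : ι) : s - f c i ≤ ρ * (f c i + 1) := by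
    obtain ⟨x, hx, hxi : f x i = s⟩ := hsurj i (Set.right_mem_Icc.2 (by linarith))
    obtain ⟨y, hy, hxy⟩ := sub_singleton_subset_smul_iff.1 hc x hx
    have hxyi : ρ * (f c i - f y i) = s - f c i := by
      simpa [hxi] using congrArg (f · i) hxy
    rw [← hxyi]
    gcongr
    linarith [(mem_boxSection.1 hy i).1]
  have hT' : (0 : ℝ) < T.card := by exact_mod_cast hT.card_pos
  have h := Finset.sum_le_sum fun i (_ : i ∈ T) => hcoord i
  simp only [Finset.sum_sub_distrib, ← Finset.mul_sum, Finset.sum_add_distrib, hsum,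
    Finset.sum_const, nsmul_eq_mul, sub_zero, zero_add, mul_one] at h
  exact le_of_mul_le_mul_left (by linarith) hT'

theorem two_le_bodyWidth_boxSection [NeZero n] [Finite ι] (hf : Function.Injective f)
    (hs : 1 ≤ s) : 2 ≤ bodyWidth (boxSection f s) (boxSection f 1) := by
  have hsub : (1 : ℝ) • boxSection f 1 ⊆ boxSection f s + {0} := by
    simpa using boxSection_mono hs
  simpa using le_bodyWidth_of_smul_subset (isGaugeBody_boxSection_one hf)
    (isBody_boxSection hf (by positivity)).isCompact.isBounded zero_le_one hsub

theorem bodyWidth_boxSection_le_two [Finite ι] {A B : Finset ι} {c : EuclideanSpace ℝ (Fin n)}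
    (hf : Function.Injective f) (hA : A.Nonempty) (hcard : A.card = B.card)
    (hsum : ∀ x, ∑ i ∈ A, f x i + ∑ i ∈ B, f x i = 0)
    (hc : c ∈ boxSection f 1) (hcA : ∀ i ∈ A, f c i = 1) :
    bodyWidth (boxSection f s) (boxSection f 1) ≤ 2 := by
  have hcard_pos : (0 : ℝ) < A.card := by exact_mod_cast hA.card_pos
  let φ : EuclideanSpace ℝ (Fin n) →ₗ[ℝ] ℝ := ∑ i ∈ A, LinearMap.proj i ∘ₗ f
  have hφ (x) : φ x = ∑ i ∈ A, f x i := by simp [φ]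
  have hφc : φ c = A.card := by simp [hφ, Finset.sum_congr rfl hcA]
  have hlow {x} (hx : x ∈ boxSection f s) (F : Finset ι) : -(F.card : ℝ) ≤ ∑ i ∈ F, f x i := by
    simpa using F.card_nsmul_le_sum (f x ·) (-1) fun i _ => (mem_boxSection.1 hx i).1
  refine bodyWidth_le_of_linearMap φ (isGaugeBody_boxSection_one hf) zero_le_two hc
    (hφc ▸ hcard_pos) fun x hx y hy => ?_
  have hxB := hlow hx B
  rw [← hcard] at hxB
  rw [hφc, hφ, hφ]
  linarith [hsum x, hlow hy A]

end BoxSection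

section HyperplaneSection

variable {n : ℕ} {ι : Type*} {f : EuclideanSpace ℝ (Fin n) →ₗ[ℝ] ι → ℝ} {s : ℝ} {T : Finset ι}

theorem exists_injective_linearMap_range_eq {T : Finset (Fin (n + 1))} (hT : T.Nonempty) :
    ∃ f : EuclideanSpace ℝ (Fin n) →ₗ[ℝ] Fin (n + 1) → ℝ,
      Function.Injective f ∧ Set.range f = {v | ∑ i ∈ T, v i = 0} := by
  let φ : Module.Dual ℝ (Fin (n + 1) → ℝ) := ∑ i ∈ T, LinearMap.proj i
  have hφ : φ ≠ 0 := fun h => by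
    have hone : φ 1 = T.card := by simp [φ]
    rw [h, LinearMap.zero_apply] at hone
    exact hT.card_ne_zero (by exact_mod_cast hone.symm)
  have hrank : Module.finrank ℝ (EuclideanSpace ℝ (Fin n)) = Module.finrank ℝ φ.ker := by
    have h := Module.Dual.finrank_ker_add_one_of_ne_zero hφ
    simpa using h.symm
  let e := LinearEquiv.ofFinrankEq _ _ hrank
  refine ⟨φ.ker.subtype ∘ₗ e, φ.ker.injective_subtype.comp e.injective, ?_⟩
  ext v
  simp [φ, e.surjective.range_comp]

theorem exists_mem_boxSection_eq {v : ι → ℝ} (hf : Set.range f = {v | ∑ i ∈ T, v i = 0})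
    (hv : ∀ i, v i ∈ Set.Icc (-1) s) (hsum : ∑ i ∈ T, v i = 0) :
    ∃ x ∈ boxSection f s, f x = v := by
  obtain ⟨x, rfl⟩ : v ∈ Set.range f := hf ▸ hsum
  exact ⟨x, mem_boxSection.2 hv, rfl⟩

theorem surjOn_boxSection (hf : Set.range f = {v | ∑ i ∈ T, v i = 0}) (hs : 1 ≤ s)
    (hsT : s + 1 ≤ T.card) (i : ι) : Set.SurjOn (f · i) (boxSection f s) (Set.Icc (-1) s) := by
  classical
  intro t ht
  suffices ∃ v : ι → ℝ, v i = t ∧ (∀ j, v j ∈ Set.Icc (-1) s) ∧ ∑ j ∈ T, v j = 0 by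
    obtain ⟨v, hvi, hv, hsum⟩ := this
    obtain ⟨x, hx, rfl⟩ := exists_mem_boxSection_eq hf hv hsum
    exact ⟨x, hx, hvi⟩
  have hm : 0 < (T.card : ℝ) - 1 := by linarith
  by_cases hi : i ∈ T
  · have hcompl : -t / (T.card - 1) ∈ Set.Icc (-1) s := by
      constructor
      · rw [le_div_iff₀ hm]
        linarith [ht.2]
      · rw [div_le_iff₀ hm]
        nlinarith [ht.1]
    refine ⟨Function.update (fun _ => -t / (T.card - 1)) i t, Function.update_self .., ?_, ?_⟩
    · exact Function.forall_update_iff _ (fun _ r => r ∈ Set.Icc (-1) s) |>.2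
        ⟨ht, fun _ _ => hcompl⟩
    · rw [Finset.sum_update_of_mem hi, Finset.sum_const, Finset.sdiff_singleton_eq_erase,
        Finset.card_erase_of_mem hi, nsmul_eq_mul, Nat.cast_pred (Finset.card_pos.2 ⟨i, hi⟩),
        mul_div_cancel₀ _ hm.ne', add_neg_cancel]
  · refine ⟨Function.update 0 i t, Function.update_self .., ?_, ?_⟩
    · exact Function.forall_update_iff _ (fun _ r => r ∈ Set.Icc (-1) s) |>.2
        ⟨ht, fun _ _ => ⟨by simp, by simpa using by linarith⟩⟩
    · rw [Finset.sum_update_of_notMem hi]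
      simp

theorem exists_mem_boxSection_one_eq_one {A B : Finset ι} (hdisj : Disjoint A B)
    (hcard : A.card = B.card)
    (hf : Set.range f = {v | ∑ i ∈ A.disjUnion B hdisj, v i = 0}) :
    ∃ c ∈ boxSection f 1, ∀ i ∈ A, f c i = 1 := by
  classical
  let v (i : ι) : ℝ := if i ∈ A then 1 else -1
  have hv (i : ι) : v i ∈ Set.Icc (-1) 1 := by
    by_cases hi : i ∈ A <;> simp [v, hi]
  have hvA : ∀ i ∈ A, v i = 1 := fun i hi => if_pos hi
  have hvB : ∀ i ∈ B, v i = -1 := fun i hi => if_neg (Finset.disjoint_right.1 hdisj hi)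
  have hsum : ∑ i ∈ A.disjUnion B hdisj, v i = 0 := by
    rw [Finset.sum_disjUnion, Finset.sum_congr rfl hvA, Finset.sum_congr rfl hvB]
    simp [hcard]
  obtain ⟨c, hc, hcv⟩ := exists_mem_boxSection_eq hf hv hsum
  exact ⟨c, hc, fun i hi => hcv ▸ hvA i hi⟩

end HyperplaneSection

theorem exists_disjoint_card_eq {α : Type*} [Fintype α] {k : ℕ} (hk : 2 * k ≤ Fintype.card α) :
    ∃ A B : Finset α, Disjoint A B ∧ A.card = k ∧ B.card = k := by
  classical
  obtain ⟨A, -, hA⟩ := Finset.exists_subset_card_eq (s := (Finset.univ : Finset α)) (n := k)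
    (by rw [Finset.card_univ]; lia)
  obtain ⟨B, hBA, hB⟩ := Finset.exists_subset_card_eq (s := Aᶜ) (n := k)
    (by rw [Finset.card_compl]; lia)
  exact ⟨A, B, Finset.subset_compl_iff_disjoint_left.1 hBA, hA, hB⟩

theorem exists_isDiamComplete_bodyDiam_div_bodyWidth_eq {n m : ℕ} {s : ℝ} (hm : Odd m)
    (hmn : m ≤ n) (hs : s ∈ Set.Icc (1 : ℝ) m) :
    ∃ K C : Set (EuclideanSpace ℝ (Fin n)), IsBody K ∧ IsGaugeBody C ∧ IsDiamComplete K C ∧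
      minkowskiAsymmetry K = s ∧ bodyDiam K C / bodyWidth K C = (s + 1) / 2 := by
  have : NeZero n := ⟨(hm.pos.trans_le hmn).ne'⟩
  have hs0 : 0 < s := one_pos.trans_le hs.1
  obtain ⟨k, hk⟩ := hm.add_one
  obtain ⟨A, B, hdisj, hAk, hBk⟩ := exists_disjoint_card_eq (α := Fin (n + 1)) (k := k)
    (by rw [Fintype.card_fin]; lia)
  have hcard : A.card = B.card := hAk.trans hBk.symm
  have hT : (A.disjUnion B hdisj).card = m + 1 := by rw [Finset.card_disjUnion, hAk, hBk, hk]
  have hTne : (A.disjUnion B hdisj).Nonempty := Finset.card_pos.1 (by lia)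
  have hA : A.Nonempty := Finset.card_pos.1 (by lia)
  obtain ⟨f, hf, hrange⟩ := exists_injective_linearMap_range_eq hTne
  have hsum (x) : ∑ i ∈ A.disjUnion B hdisj, f x i = 0 := hrange.subset ⟨x, rfl⟩
  have hsurj := surjOn_boxSection hrange hs.1 (by rw [hT]; push_cast; linarith [hs.2])
  obtain ⟨c, hc, hcA⟩ := exists_mem_boxSection_one_eq_one hdisj hcard hrange
  have hwidth : bodyWidth (boxSection f s) (boxSection f 1) = 2 :=
    (bodyWidth_boxSection_le_two hf hA hcard
      (fun x => by rw [← hsum x, Finset.sum_disjUnion]) hc hcA).antisymm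
        (two_le_bodyWidth_boxSection hf hs.1)
  refine ⟨boxSection f s, boxSection f 1, isBody_boxSection hf hs0, isGaugeBody_boxSection_one hf,
    isDiamComplete_boxSection hf hs0 hsurj, ?_, by rw [bodyDiam_boxSection hf hs0 hsurj, hwidth]⟩
  exact le_antisymm (minkowskiAsymmetry_boxSection_le hs.1)
    (le_minkowskiAsymmetry_boxSection hf hs0 hTne hsum hsurj)

theorem theorem1p3_general (n : ℕ) (hn : 1 ≤ n) :
    (∀ K C : Set (EuclideanSpace ℝ (Fin n)), Bornology.IsBounded K → (interior K).Nonempty →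
      IsGaugeBody C → IsPseudoComplete K C →
      bodyDiam K C / bodyWidth K C ≤ (minkowskiAsymmetry K + 1) / 2) ∧
    (∀ m ≤ n, Odd m → ∀ s : ℝ, s ∈ Set.Icc (1 : ℝ) (m : ℝ) →
      ∃ K C : Set (EuclideanSpace ℝ (Fin n)), IsBody K ∧ IsGaugeBody C ∧ IsDiamComplete K C ∧
        minkowskiAsymmetry K = s ∧ bodyDiam K C / bodyWidth K C = (s + 1) / 2) := by
  have : NeZero n := ⟨Nat.one_le_iff_ne_zero.1 hn⟩
  exact ⟨fun _ _ hK hint hC h => h.bodyDiam_div_bodyWidth_le hC hK hint,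
    fun _ hmn hm _ hs => exists_isDiamComplete_bodyDiam_div_bodyWidth_eq hm hmn hs⟩

theorem theorem1p3 (n : ℕ) (hn : 1 ≤ n) :
    (∀ K C : Set (EuclideanSpace ℝ (Fin n)), IsBody K → IsGaugeBody C → IsPseudoComplete K C →
      bodyDiam K C / bodyWidth K C ≤ (minkowskiAsymmetry K + 1) / 2) ∧
    (2 < n → Odd n → ∀ s : ℝ, s ∈ Set.Icc (1 : ℝ) (n : ℝ) →
      ∃ K C : Set (EuclideanSpace ℝ (Fin n)), IsBody K ∧ IsGaugeBody C ∧ IsDiamComplete K C ∧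
        minkowskiAsymmetry K = s ∧ bodyDiam K C / bodyWidth K C = (s + 1) / 2) ∧
    (2 < n → Even n → ∀ s : ℝ, s ∈ Set.Icc (1 : ℝ) ((n : ℝ) - 1) →
      ∃ K C : Set (EuclideanSpace ℝ (Fin n)), IsBody K ∧ IsGaugeBody C ∧ IsDiamComplete K C ∧
        minkowskiAsymmetry K = s ∧ bodyDiam K C / bodyWidth K C = (s + 1) / 2) := by
  obtain ⟨hle, hsharp⟩ := theorem1p3_general n hn
  exact ⟨fun K C hK => hle K C hK.isCompact.isBounded hK.interior_nonempty,
    fun _ hodd => hsharp n le_rfl hodd, fun _ heven s hs =>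
      hsharp (n - 1) (n.sub_le 1) (Nat.Even.sub_odd hn heven odd_one) s (by rwa [Nat.cast_pred hn])⟩
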